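/- **Conventions.** Function spaces are complex: $\ell^2(\mathbb Z)=\ell^2(\mathbb Z;\mathbb C)$ and $L^2(X)=L^2(X;\mathbb C)$. If a group $G$ acts by isometries on a metric space $M$, the orbit space $M/G$ carries the quotient distance $$d(G\cdot x,G\cdot y)=\inf\{d_M(p,q): p\in G\cdot x,\ q\in G\cdot y\}.$$ The group $\mathbb Z$ acts on $\ell^2(\mathbb Z)$ by translation, and a group $G$ acting on a measure space $X$ by measure space automorphisms acts on $L^2(X)$ by $(g\cdot f)(x)=f(g^{-1}\cdot x)$. For a map $f\colon M\to N$ between metric spaces, where $M$ has at least two points, let $\alpha,\beta\in[0,\infty]$ be the largest and the smallest constant, respectively, with $\alpha\, d_M(x,x')\le d_N(f(x),f(x'))\le \beta\, d_M(x,x')$ for all $x,x'\in M$; the distortion of $f$ is $\beta/\alpha$, where division by zero is infinite, and $f$ is bilipschitz if its distortion is finite. The Euclidean distortion $c_2(M)\in[1,\infty]$ is the infimum of all $c$ for which there exist a Hilbert space $H$ and a bilipschitz map $M\to H$ of distortion $c$ (so $c_2(M)=\infty$ if there is none). **Theorem.** For each $n\in\mathbb N$, let $X_n$ be a measure space and let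 $G_n$ be a second countable locally compact abelian group, equipped with a Haar measure, that acts freely on $X_n$ by measure space automorphisms and contains a discrete cyclic subgroup of (possibly infinite) order at least $n$. Suppose that this action admits a measurable fundamental domain $\Omega_n\subseteq X_n$ (a measurable set containing exactly one point of each orbit) with a nonzero $\sigma$-finite measure $\nu_n$ such that $L^2(\Omega_n,\nu_n)$ is separable and the mapping $G_n\times(\Omega_n,\nu_n)\to X_n$, $(g,\omega)\mapsto g\cdot\omega$, is an isomorphism of measure spaces (a measurable bijection with measurable inverse that carries the product measure to the measure of $X_n$). Then $$c_2\bigl(\ell^2(\mathbb Z)/\mathbb Z\bigr)\ \le\ \liminf_{n\to\infty}\, c_2\bigl(L^2(X_n)/G_n\bigr).$$ -/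

import Mathlib

open MeasureTheory Filter
open scoped ENNReal

/-! ### Quotients of metric spaces by groups of isometries -/

/-- The set `X / G` of orbits. (A type synonym of its own, so that it carries no other
topology than the one of the quotient distance below.) -/
def OrbitSpace (G X : Type*) [Group G] [MulAction G X] : Type _ :=
  MulAction.orbitRel.Quotient G X

namespace OrbitSpace

variable {G X : Type*} [Group G] [MulAction G X]

/-- The orbit `G • x`. -/
def mk (G : Type*) {X : Type*} [Group G] [MulAction G X] (x : X) : OrbitSpace G X :=
  Quotient.mk (MulAction.orbitRel G X) x

theorem mk_surjective (A : OrbitSpace G X) : ∃ x, mk G x = A :=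
  Quotient.exists_rep A

theorem mk_eq_mk {x y : X} : mk G x = mk G y ↔ ∃ g : G, g • y = x := by
  exact (Quotient.eq (r := MulAction.orbitRel G X)).trans MulAction.orbitRel_apply

/-- For a group `G` acting by isometries on `X`, the quotient distance on `X / G`:
`d(G • x, G • y)` is the infimum of `d(p, q)` over `p ∈ G • x` and `q ∈ G • y`. -/
noncomputable instance [PseudoEMetricSpace X] [IsIsometricSMul G X] :
    PseudoEMetricSpace (OrbitSpace G X) where
  edist A B := ⨅ (p : X) (_ : mk G p = A) (q : X) (_ : mk G q = B), edist p q
  edist_self A := by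
    obtain ⟨x, rfl⟩ := mk_surjective A
    refine le_antisymm ?_ zero_le
    exact iInf₂_le_of_le x rfl (iInf₂_le_of_le x rfl (edist_self x).le)
  edist_comm A B := by
    refine le_antisymm ?_ ?_ <;>
    · refine le_iInf₂ fun p hp => le_iInf₂ fun q hq => ?_
      exact iInf₂_le_of_le q hq (iInf₂_le_of_le p hp (edist_comm q p).le)
  edist_triangle A B C := by
    simp only [ENNReal.iInf_add, ENNReal.add_iInf]
    refine le_iInf₂ fun p hp => le_iInf₂ fun r hr => le_iInf₂ fun x hx => le_iInf₂ fun q hq => ?_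
    obtain ⟨g, rfl⟩ := mk_eq_mk.1 (hq.trans hp.symm)
    have hgr : mk G (g • r) = C := (mk_eq_mk.2 ⟨g, rfl⟩).trans hr
    refine iInf₂_le_of_le x hx (iInf₂_le_of_le (g • r) hgr ?_)
    rw [← edist_smul_left g p r]
    exact edist_triangle _ _ _

end OrbitSpace

/-! ### Distortion -/

/-- The optimal lower Lipschitz bound: the largest `α ∈ [0, ∞]` with
`α * d(x, x') ≤ d(f x, f x')` for all `x, x'`. -/
noncomputable def lowerLipschitzBound {X Y : Type*} [PseudoEMetricSpace X] [PseudoEMetricSpace Y]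
    (f : X → Y) : ℝ≥0∞ :=
  sSup {α : ℝ≥0∞ | ∀ x x', α * edist x x' ≤ edist (f x) (f x')}

/-- The optimal upper Lipschitz bound: the smallest `β ∈ [0, ∞]` with
`d(f x, f x') ≤ β * d(x, x')` for all `x, x'`. -/
noncomputable def upperLipschitzBound {X Y : Type*} [PseudoEMetricSpace X] [PseudoEMetricSpace Y]
    (f : X → Y) : ℝ≥0∞ :=
  sInf {β : ℝ≥0∞ | ∀ x x', edist (f x) (f x') ≤ β * edist x x'}

open Classical in
/-- The distortion `β / α` of a map between metric spaces (the domain having at least two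
points), with the convention that division by zero is infinite. -/
noncomputable def distortion {X Y : Type*} [PseudoEMetricSpace X] [PseudoEMetricSpace Y]
    (f : X → Y) : ℝ≥0∞ :=
  if lowerLipschitzBound f = 0 then ∞ else upperLipschitzBound f / lowerLipschitzBound f

/-- The Euclidean distortion `c₂(X)` of a metric space with at least two points: the infimum of
the `c` for which there are a Hilbert space `H` and a bilipschitz map `X → H` of distortion `c`
(and `∞` if there is no bilipschitz map).
A complex Hilbert space is also a real one with the same metric, so real Hilbert spaces are the
general case; and `H` may be replaced by the closed span of the image of `X`, which
is isometric to a Hilbert space in the universe of `X`, so the restriction to that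
universe loses nothing. -/
noncomputable def euclideanDistortion.{u} (X : Type u) [PseudoEMetricSpace X] : ℝ≥0∞ :=
  sInf {c : ℝ≥0∞ | ∃ (H : Type u) (_ : NormedAddCommGroup H) (_ : InnerProductSpace ℝ H)
    (_ : CompleteSpace H) (f : X → H), distortion f < ∞ ∧ distortion f = c}

/-! ### The translation action of `ℤ` on `ℓ²(ℤ)` -/

/-- The complex Hilbert space `ℓ²(ℤ)`. -/
abbrev EllTwoInt : Type := lp (fun _ : ℤ => ℂ) 2

theorem memℓp_two_translate (k : ℤ) (a : EllTwoInt) : Memℓp (fun i : ℤ => a (i - k)) 2 := by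
  have h := (memℓp_gen_iff (by norm_num)).1 (lp.memℓp a)
  exact (memℓp_gen_iff (by norm_num)).2 ((Equiv.subRight k).summable_iff.2 h)

/-- `ℤ` (written multiplicatively) acts on `ℓ²(ℤ)` by translation: `(k • a) i = a (i - k)`. -/
noncomputable instance : MulAction (Multiplicative ℤ) EllTwoInt where
  smul k a := ⟨fun i => a (i - k.toAdd), memℓp_two_translate k.toAdd a⟩
  one_smul a := by
    apply lp.ext
    funext i
    exact congrArg a (sub_zero i)
  mul_smul k l a := by
    apply lp.ext
    funext i
    refine congrArg a ?_
    change i - (k.toAdd + l.toAdd) = i - k.toAdd - l.toAdd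
    ring

instance : IsIsometricSMul (Multiplicative ℤ) EllTwoInt where
  isometry_smul k := by
    refine Isometry.of_dist_eq fun a b => ?_
    rw [dist_eq_norm, dist_eq_norm, lp.norm_eq_tsum_rpow (by norm_num),
      lp.norm_eq_tsum_rpow (by norm_num)]
    congr 1
    exact (Equiv.subRight k.toAdd).tsum_eq
      (fun i : ℤ => ‖(a - b : EllTwoInt) i‖ ^ (2 : ℝ≥0∞).toReal)

/-! ### Translation quotients of `L²` -/

/-- `L²(X) / G` for a group `G` acting on the measure space `(X, μ)` by measure space
automorphisms. The action of `Gᵈᵐᵃ` on `L²(X)` sends `f` to the class of `x ↦ f (g • x)`, `g ∈ G`;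
its orbits are those of `G` acting by `(g • f) x = f (g⁻¹ • x)`. -/
abbrev LTwoQuotient (G X : Type*) [Group G] [MulAction G X] [MeasurableSpace X]
    [MeasurableConstSMul G X] (μ : Measure X) [SMulInvariantMeasure G X μ] : Type _ :=
  OrbitSpace Gᵈᵐᵃ (Lp ℂ 2 μ)

/-- `Ω` is a measurable fundamental domain: a measurable set that contains exactly one point of
each orbit. -/
def IsMeasurableFundamentalDomain (G : Type*) {X : Type*} [Group G] [MulAction G X]
    [MeasurableSpace X] (Ω : Set X) : Prop :=
  MeasurableSet Ω ∧ ∀ x : X, ∃! ω, ω ∈ Ω ∧ ω ∈ MulAction.orbit G x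

/-- `f` is an isomorphism of measure spaces: a measurable bijection with measurable inverse
that carries `μ` to `ν`. -/
def IsMeasureSpaceIso {X Y : Type*} [MeasurableSpace X] [MeasurableSpace Y] (f : X → Y)
    (μ : Measure X) (ν : Measure Y) : Prop :=
  ∃ e : X ≃ᵐ Y, ⇑e = f ∧ MeasurePreserving f μ ν

/-! The Euclidean distortion is lower semicontinuous in the following sense: if maps `φ n : M → N n`
are such that the distances of the images converge to the distances in `M`, then
`c₂(M) ≤ liminf c₂(N n)` (`euclideanDistortion_le_liminf`). Indeed, embeddings of the `N n` of
distortion less than `C` have Gram kernels that, pulled back to `M`, converge pointwise along an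
ultrafilter; the limit is a positive semidefinite kernel, hence the Gram kernel of a map of `M` into
a Hilbert space, and the bounds on distances survive in the limit.

It remains to map `ℓ²(ℤ) / ℤ` to `L²(X n) / G n` in this way. Let `a` generate a discrete cyclic
subgroup of order at least `n`. The normalized indicator function `e` of the product of a small
neighborhood of `1 : G n` with a subset of the fundamental domain has the properties of an
`IsSpreadVector`: the coefficients `⟪e, g • e⟫` lie in `[0, 1]`, and for each `g` at most one of any
`n` consecutive `g * a ^ i` has a nonzero coefficient. A sequence `x` supported in `[-R, R]` is sent
to `∑ x k • (a ^ k • e)`. If `4 * R + 1 < n`, the inner product of one such vector with a translate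
of another is a multiple, with factor in `[0, 1]`, of a correlation of the two sequences, and every
correlation occurs; since correlations for large shifts vanish, the factors do not affect the
supremum of the real parts. The distance of the orbits therefore depends on the two sequences only
(`IsSpreadVector.edist_mk_translateSum_eq`). The delta sequence in `ℓ²(ℤ)` is a spread vector as
well, so this distance is the one in `ℓ²(ℤ) / ℤ`. Truncating arbitrary sequences to `[-R, R]` with
`R` of the order of `n / 4` gives the maps `φ n`. -/

open scoped InnerProductSpace ComplexConjugate Topology

/-! ### Distortion and rescaled embeddings -/

theorem lowerLipschitzBound_mul_edist_le {M Y : Type*} [PseudoEMetricSpace M]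
    [PseudoEMetricSpace Y] (f : M → Y) (x y : M) :
    lowerLipschitzBound f * edist x y ≤ edist (f x) (f y) := by
  rw [lowerLipschitzBound, ENNReal.sSup_mul]
  exact iSup₂_le fun α hα => hα x y

/-- A space of Euclidean distortion less than `C` has an embedding into a Hilbert space that does
not decrease distances and increases them at most by the factor `C`. -/
theorem exists_embedding_of_euclideanDistortion_lt.{u} {M : Type u} [PseudoEMetricSpace M]
    {C : ℝ≥0∞} (h : euclideanDistortion M < C) :
    ∃ (H : Type u) (_ : NormedAddCommGroup H) (_ : InnerProductSpace ℝ H) (f : M → H),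
      ∀ x y, edist x y ≤ edist (f x) (f y) ∧ edist (f x) (f y) ≤ C * edist x y := by
  obtain ⟨_, ⟨H, i₁, i₂, _, f, hfin, rfl⟩, hC⟩ := sInf_lt_iff.1 h
  have h0 : lowerLipschitzBound f ≠ 0 := fun h0 => by simp [distortion, h0] at hfin
  have hlow := lowerLipschitzBound_mul_edist_le f
  by_cases htop : lowerLipschitzBound f = ∞
  · -- All distances in `M` vanish in this case, so the zero map will do.
    refine ⟨H, i₁, i₂, fun _ => 0, fun x y => ?_⟩
    have hxy : edist x y = 0 := by
      by_contra hne
      have := hlow x y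
      rw [htop, ENNReal.top_mul hne, top_le_iff] at this
      exact edist_ne_top _ _ this
    simp [hxy]
  lift lowerLipschitzBound f to NNReal using htop with α hα
  have hα0 : α ≠ 0 := by exact_mod_cast h0
  have hup : upperLipschitzBound f < C * α := by
    rw [distortion, if_neg (by rw [← hα]; exact h0), ← hα] at hC
    rwa [ENNReal.div_lt_iff (Or.inl h0) (Or.inl ENNReal.coe_ne_top)] at hC
  obtain ⟨β, hβ, hβC⟩ := sInf_lt_iff.1 hup
  refine ⟨H, i₁, i₂, fun x => (α : ℝ)⁻¹ • f x, fun x y => ?_⟩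
  dsimp only
  rw [edist_smul₀, ENNReal.smul_def, smul_eq_mul, nnnorm_inv, NNReal.nnnorm_eq,
    ENNReal.coe_inv hα0]
  constructor
  · calc edist x y = (α : ℝ≥0∞)⁻¹ * (α * edist x y) := by
          rw [← mul_assoc, ENNReal.inv_mul_cancel h0 ENNReal.coe_ne_top, one_mul]
      _ ≤ _ := by gcongr; exact hlow x y
  · calc (α : ℝ≥0∞)⁻¹ * edist (f x) (f y) ≤ (α : ℝ≥0∞)⁻¹ * (C * α * edist x y) := by
          gcongr
          exact (hβ x y).trans (by gcongr)
      _ = (α : ℝ≥0∞)⁻¹ * α * (C * edist x y) := by ring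
      _ = C * edist x y := by rw [ENNReal.inv_mul_cancel h0 ENNReal.coe_ne_top, one_mul]

theorem euclideanDistortion_le_of_embedding.{u} {M H : Type u} [PseudoEMetricSpace M]
    [NormedAddCommGroup H] [InnerProductSpace ℝ H] [CompleteSpace H] {C : ℝ≥0∞} (hC : C ≠ ∞)
    (f : M → H) (hlow : ∀ x y, edist x y ≤ edist (f x) (f y))
    (hup : ∀ x y, edist (f x) (f y) ≤ C * edist x y) : euclideanDistortion M ≤ C := by
  have h1 : 1 ≤ lowerLipschitzBound f := le_sSup fun x y => by simpa using hlow x y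
  have h0 : lowerLipschitzBound f ≠ 0 := (one_pos.trans_le h1).ne'
  have hle : distortion f ≤ C := by
    rw [distortion, if_neg h0]
    calc _ ≤ C / 1 := ENNReal.div_le_div (sInf_le (by exact hup)) h1
      _ = C := div_one C
  have hmem : euclideanDistortion M ≤ distortion f :=
    sInf_le ⟨H, inferInstance, inferInstance, inferInstance, f, hle.trans_lt hC.lt_top, rfl⟩
  exact hmem.trans hle

/-! ### Positive semidefinite kernels -/

theorem posSemidef_inner {M H : Type*} [NormedAddCommGroup H] [InnerProductSpace ℝ H]
    (f : M → H) : (Matrix.of fun x y => ⟪f x, f y⟫_ℝ).PosSemidef := by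
  refine ⟨Matrix.IsHermitian.ext fun x y => by simp [real_inner_comm], fun c => ?_⟩
  have : c.sum (fun x a => c.sum fun y b => star a * Matrix.of (fun x y => ⟪f x, f y⟫_ℝ) x y * b)
      = ⟪c.sum fun x a => a • f x, c.sum fun x a => a • f x⟫_ℝ := by
    simp only [Finsupp.sum, sum_inner, inner_sum, real_inner_smul_left, real_inner_smul_right]
    refine Finset.sum_congr rfl fun x _ => Finset.sum_congr rfl fun y _ => ?_
    simp only [star_trivial, Matrix.of_apply, real_inner_comm (f x) (f y)]
    ring
  rw [this]
  exact real_inner_self_nonneg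

/-- A positive semidefinite real kernel is the Gram matrix of a map into a Hilbert space. -/
theorem exists_inner_eq_of_posSemidef.{u} {M : Type u} {k : Matrix M M ℝ} (hk : k.PosSemidef) :
    ∃ (H : Type u) (_ : NormedAddCommGroup H) (_ : InnerProductSpace ℝ H) (_ : CompleteSpace H)
      (f : M → H), ∀ x y, ⟪f x, f y⟫_ℝ = k x y := by
  -- Mathlib's kernels are operator-valued: `k x y` becomes multiplication by `k x y` on `ℝ`.
  let K : Matrix M M (ℝ →L[ℝ] ℝ) := Matrix.of fun x y => k x y • ContinuousLinearMap.id ℝ ℝ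
  have hK : K.PosSemidef := by
    have htfae := (RKHS.posSemidef_tfae (K := K)).out 0 2
    refine htfae.2 (And.intro ?_ fun v => ?_)
    · refine Matrix.IsHermitian.ext fun x y => ?_
      have := hk.1.apply x y
      simp only [star_trivial] at this
      simp only [K, Matrix.of_apply, this]
      ext
      simp [ContinuousLinearMap.star_eq_adjoint, ContinuousLinearMap.adjoint_id]
    · convert! hk.2 v using 1
      simp only [K, RCLike.re_to_real, Finsupp.sum]
      refine Finset.sum_congr rfl fun x _ => Finset.sum_congr rfl fun y _ => ?_
      have := hk.1.apply x y
      simp only [star_trivial] at this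
      simp [this]
      ring
  have : Fact K.PosSemidef := ⟨hK⟩
  refine ⟨RKHS.OfKernel K, inferInstance, inferInstance, inferInstance,
    fun x => RKHS.kerFun (RKHS.OfKernel K) x 1, fun x y => ?_⟩
  have := RKHS.kernel_inner (H := RKHS.OfKernel K) y x (1 : ℝ) (1 : ℝ)
  rw [RKHS.OfKernel.kernel_ofKernel] at this
  have h2 := hk.1.apply x y
  simp only [star_trivial] at h2
  rw [← this]
  simp [K, h2]

theorem posSemidef_of_tendsto {ι M : Type*} {l : Filter ι} [l.NeBot] {k : ι → Matrix M M ℝ}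
    {k' : Matrix M M ℝ} (hk : ∀ᶠ i in l, (k i).PosSemidef)
    (h : ∀ x y, Tendsto (fun i => k i x y) l (𝓝 (k' x y))) : k'.PosSemidef := by
  refine ⟨Matrix.IsHermitian.ext fun x y => ?_, fun c => ?_⟩
  · refine tendsto_nhds_unique (h y x) ((h x y).congr' ?_)
    filter_upwards [hk] with i hi
    simpa using hi.1.apply y x
  · refine ge_of_tendsto (x := l) (f := fun i => c.sum fun x a => c.sum fun y b =>
      star a * k i x y * b) ?_ (hk.mono fun i hi => hi.2 c)
    exact tendsto_finsetSum _ fun x _ => tendsto_finsetSum _ fun y _ =>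
      ((h x y).const_mul _).mul_const _

/-! ### Semicontinuity of the Euclidean distortion -/

/-- The Gram kernel, relative to the base point `x₀`, of an embedding of a space of Euclidean
distortion less than `C`, pulled back along `φ`. -/
theorem exists_kernel_of_euclideanDistortion_lt {M N : Type*} [PseudoEMetricSpace N]
    {C : NNReal} (h : euclideanDistortion N < C) (φ : M → N) (x₀ : M)
    (hfin : ∀ x y, edist (φ x) (φ y) ≠ ∞) :
    ∃ k : Matrix M M ℝ, k.PosSemidef ∧
      (∀ x y, (edist (φ x) (φ y)).toReal ^ 2 ≤ k x x + k y y - 2 * k x y) ∧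
      (∀ x y, k x x + k y y - 2 * k x y ≤ (C * (edist (φ x) (φ y)).toReal) ^ 2) ∧
      ∀ x y, |k x y| ≤ C * (edist (φ x) (φ x₀)).toReal * (C * (edist (φ y) (φ x₀)).toReal) := by
  obtain ⟨H, _, _, f, hf⟩ := exists_embedding_of_euclideanDistortion_lt h
  have hlow : ∀ x y, (edist (φ x) (φ y)).toReal ≤ ‖f (φ x) - f (φ y)‖ := fun x y => by
    rw [← dist_eq_norm, dist_edist]
    exact ENNReal.toReal_mono (edist_ne_top _ _) (hf _ _).1
  have hup : ∀ x y, ‖f (φ x) - f (φ y)‖ ≤ C * (edist (φ x) (φ y)).toReal := fun x y => by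
    rw [← dist_eq_norm, dist_edist, ← ENNReal.coe_toReal, ← ENNReal.toReal_mul]
    exact ENNReal.toReal_mono (ENNReal.mul_ne_top ENNReal.coe_ne_top (hfin x y)) (hf _ _).2
  have hsq : ∀ x y, ⟪f (φ x) - f (φ x₀), f (φ x) - f (φ x₀)⟫_ℝ
      + ⟪f (φ y) - f (φ x₀), f (φ y) - f (φ x₀)⟫_ℝ
      - 2 * ⟪f (φ x) - f (φ x₀), f (φ y) - f (φ x₀)⟫_ℝ = ‖f (φ x) - f (φ y)‖ ^ 2 := fun x y => by
    rw [← sub_sub_sub_cancel_right (f (φ x)) (f (φ y)) (f (φ x₀)),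
      @norm_sub_sq_real, real_inner_self_eq_norm_sq, real_inner_self_eq_norm_sq]
    ring
  refine ⟨_, posSemidef_inner fun x => f (φ x) - f (φ x₀), fun x y => ?_, fun x y => ?_,
    fun x y => ?_⟩
  · simp only [Matrix.of_apply, hsq]
    exact pow_le_pow_left₀ ENNReal.toReal_nonneg (hlow x y) 2
  · simp only [Matrix.of_apply, hsq]
    exact pow_le_pow_left₀ (norm_nonneg _) (hup x y) 2
  · exact (abs_real_inner_le_norm _ _).trans
      (mul_le_mul (hup x x₀) (hup y x₀) (norm_nonneg _) (by positivity))

/-- If the distances in `M` are limits of distances in the spaces `N n`, then the Euclidean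
distortion of `M` is at most the lower limit of the Euclidean distortions of the `N n`: the Gram
kernels of embeddings of the `N n` converge along an ultrafilter to a positive semidefinite kernel
on `M`, and this kernel comes from an embedding of `M`. -/
theorem euclideanDistortion_le_liminf.{u, v} {M : Type u} [PseudoEMetricSpace M] [Nonempty M]
    (hM : ∀ x y : M, edist x y ≠ ∞) {N : ℕ → Type v} [∀ n, PseudoEMetricSpace (N n)]
    (hN : ∀ n, ∀ x y : N n, edist x y ≠ ∞) (φ : ∀ n, M → N n)
    (hφ : ∀ x y, Tendsto (fun n => edist (φ n x) (φ n y)) atTop (𝓝 (edist x y))) :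
    euclideanDistortion M ≤ liminf (fun n => euclideanDistortion (N n)) atTop := by
  by_contra! hlt
  obtain ⟨C, hC, hCM⟩ := ENNReal.lt_iff_exists_nnreal_btwn.1 hlt
  refine hCM.not_ge ?_
  obtain ⟨x₀⟩ := ‹Nonempty M›
  have hfreq : ∃ᶠ n in atTop, euclideanDistortion (N n) < C :=
    frequently_lt_of_liminf_lt (h := hC)
  have : (atTop ⊓ 𝓟 {n | euclideanDistortion (N n) < C}).NeBot :=
    frequently_mem_iff_neBot.1 hfreq
  set 𝒰 : Ultrafilter ℕ := Ultrafilter.of (atTop ⊓ 𝓟 {n | euclideanDistortion (N n) < C})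
  have h𝒰 : (𝒰 : Filter ℕ) ≤ atTop ⊓ 𝓟 {n | euclideanDistortion (N n) < C} :=
    Ultrafilter.of_le _
  have hS : ∀ᶠ n in (𝒰 : Filter ℕ), euclideanDistortion (N n) < C :=
    (h𝒰.trans inf_le_right) (mem_principal_self _)
  have hd : ∀ x y, Tendsto (fun n => (edist (φ n x) (φ n y)).toReal) 𝒰
      (𝓝 (edist x y).toReal) := fun x y =>
    (ENNReal.tendsto_toReal (hM x y)).comp ((hφ x y).mono_left (h𝒰.trans inf_le_left))
  have hker : ∀ n, ∃ k : Matrix M M ℝ, euclideanDistortion (N n) < C → _ := fun n => by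
    by_cases h : euclideanDistortion (N n) < C
    · obtain ⟨k, hk⟩ := exists_kernel_of_euclideanDistortion_lt h (φ n) x₀ fun _ _ => hN n _ _
      exact ⟨k, fun _ => hk⟩
    · exact ⟨0, fun h' => (h h').elim⟩
  choose k hk using hker
  have hlim : ∀ x y, ∃ r, Tendsto (fun n => k n x y) 𝒰 (nhds r) := fun x y => by
    set B : ℕ → ℝ := fun n => C * (edist (φ n x) (φ n x₀)).toReal *
      (C * (edist (φ n y) (φ n x₀)).toReal)
    have hB : Tendsto B 𝒰 (nhds _) := ((hd x x₀).const_mul _).mul ((hd y x₀).const_mul _)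
    obtain ⟨b, hb⟩ := hB.isBoundedUnder_le
    have hmem : ∀ᶠ n in (𝒰 : Filter ℕ), k n x y ∈ Set.Icc (-b) b := by
      filter_upwards [hS, hb] with n hn hnb
      exact abs_le.1 (((hk n hn).2.2.2 x y).trans hnb)
    obtain ⟨r, -, hr⟩ := isCompact_Icc.ultrafilter_le_nhds' (𝒰.map fun n => k n x y) hmem
    exact ⟨r, hr⟩
  choose k' hk' using hlim
  have hpsd : Matrix.PosSemidef (Matrix.of k') :=
    posSemidef_of_tendsto (hS.mono fun n hn => (hk n hn).1) hk'
  obtain ⟨H, _, _, _, F, hF⟩ := exists_inner_eq_of_posSemidef hpsd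
  have hnorm : ∀ x y, ‖F x - F y‖ ^ 2 = k' x x + k' y y - 2 * k' x y := fun x y => by
    rw [@norm_sub_sq_real, ← real_inner_self_eq_norm_sq, ← real_inner_self_eq_norm_sq,
      hF, hF, hF]
    simp only [Matrix.of_apply]
    ring
  have hlim' : ∀ x y, Tendsto (fun n => k n x x + k n y y - 2 * k n x y) 𝒰
      (𝓝 (‖F x - F y‖ ^ 2)) := fun x y => by
    rw [hnorm]
    exact ((hk' x x).add (hk' y y)).sub ((hk' x y).const_mul 2)
  refine euclideanDistortion_le_of_embedding ENNReal.coe_ne_top F (fun x y => ?_) fun x y => ?_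
  · have h := le_of_tendsto_of_tendsto ((hd x y).pow 2) (hlim' x y)
      (hS.mono fun n hn => (hk n hn).2.1 x y)
    rw [← ENNReal.ofReal_toReal (hM x y), edist_dist, dist_eq_norm]
    exact ENNReal.ofReal_le_ofReal ((sq_le_sq₀ ENNReal.toReal_nonneg (norm_nonneg _)).1 h)
  · have h := le_of_tendsto_of_tendsto (hlim' x y) (((hd x y).const_mul (C : ℝ)).pow 2)
      (hS.mono fun n hn => (hk n hn).2.2.1 x y)
    rw [← ENNReal.ofReal_toReal (hM x y), edist_dist, dist_eq_norm, ← ENNReal.ofReal_coe_nnreal,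
      ← ENNReal.ofReal_mul C.coe_nonneg]
    exact ENNReal.ofReal_le_ofReal
      ((sq_le_sq₀ (norm_nonneg _) (mul_nonneg C.coe_nonneg ENNReal.toReal_nonneg)).1 h)

/-! ### The quotient distance -/

namespace OrbitSpace

variable {G X : Type*} [Group G] [MulAction G X] [PseudoEMetricSpace X] [IsIsometricSMul G X]

theorem edist_mk_mk (x y : X) : edist (mk G x) (mk G y) = ⨅ g : G, edist x (g • y) := by
  refine le_antisymm (le_iInf fun g => ?_) ?_
  · exact iInf₂_le_of_le x rfl (iInf₂_le_of_le (g • y) (mk_eq_mk.2 ⟨g, rfl⟩) le_rfl)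
  · refine le_iInf₂ fun p hp => le_iInf₂ fun q hq => ?_
    obtain ⟨g, rfl⟩ := mk_eq_mk.1 hp
    obtain ⟨h, rfl⟩ := mk_eq_mk.1 hq
    refine iInf_le_of_le (g⁻¹ * h) ?_
    rw [mul_smul, ← edist_smul_left g x, smul_inv_smul]

theorem edist_mk_mk_le (x y : X) : edist (mk G x) (mk G y) ≤ edist x y := by
  rw [edist_mk_mk]
  exact iInf_le_of_le 1 (by rw [one_smul])

theorem edist_ne_top_of_forall (h : ∀ x y : X, edist x y ≠ ∞) (A B : OrbitSpace G X) :
    edist A B ≠ ∞ := by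
  obtain ⟨x, rfl⟩ := mk_surjective A
  obtain ⟨y, rfl⟩ := mk_surjective B
  exact ne_top_of_le_ne_top (h x y) (edist_mk_mk_le x y)

end OrbitSpace

/-! ### Finite combinations of translates of a vector -/

section TranslateSum

theorem norm_smul_eq_of_isIsometricSMul {G E : Type*} [Group G] [NormedAddCommGroup E]
    [DistribMulAction G E] [IsIsometricSMul G E] (g : G) (v : E) : ‖g • v‖ = ‖v‖ := by
  rw [← dist_zero_right, ← smul_zero g, dist_smul, dist_zero_right]

/-- The correlation `∑ conj (x k) * y l`, over the `k`, `l` in `[-R, R]` with `k - l = m`. -/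
noncomputable def correlation (R : ℕ) (x y : ℤ → ℂ) (m : ℤ) : ℂ :=
  ∑ k ∈ Finset.Icc (-R : ℤ) R, ∑ l ∈ Finset.Icc (-R : ℤ) R,
    if k - l = m then conj (x k) * y l else 0

theorem correlation_two_mul_add_one (R : ℕ) (x y : ℤ → ℂ) :
    correlation R x y (2 * R + 1) = 0 := by
  refine Finset.sum_eq_zero fun k hk => Finset.sum_eq_zero fun l hl => if_neg ?_
  rw [Finset.mem_Icc] at hk hl
  omega

variable {G E : Type*} [CommGroup G] [NormedAddCommGroup E] [InnerProductSpace ℂ E]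
  [DistribMulAction G E]

/-- The linear combination `∑ x k • (a ^ k • e)`, over the `k` in `[-R, R]`, of translates
of `e`. -/
noncomputable def translateSum (a : G) (e : E) (R : ℕ) (x : ℤ → ℂ) : E :=
  ∑ k ∈ Finset.Icc (-R : ℤ) R, x k • a ^ k • e

/-- The unit vector `e` has nonnegative matrix coefficients `⟪e, g • e⟫`, and each coset of the
powers of `a` meets the support of these coefficients at most once in every `n` consecutive
powers. For `g = 1` this says that `n` consecutive translates `a ^ k • e` are orthonormal. -/
structure IsSpreadVector (a : G) (e : E) (n : ℕ) : Prop where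
  norm_eq_one : ‖e‖ = 1
  inner_nonneg : ∀ g : G, ∃ r : ℝ, 0 ≤ r ∧ ⟪e, g • e⟫_ℂ = r
  eq_of_inner_ne_zero : ∀ (g : G) (i j : ℤ), |i - j| < n →
    ⟪e, (g * a ^ i) • e⟫_ℂ ≠ 0 → ⟪e, (g * a ^ j) • e⟫_ℂ ≠ 0 → i = j

theorem IsSpreadVector.inner_zpow_smul {a : G} {e : E} {n : ℕ} (he : IsSpreadVector a e n)
    {i : ℤ} (hi : |i| < n) :
    ⟪e, a ^ i • e⟫_ℂ = if i = 0 then 1 else 0 := by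
  have h1 : ⟪e, e⟫_ℂ = 1 := by
    rw [inner_self_eq_norm_sq_to_K, he.norm_eq_one]
    simp
  split_ifs with h
  · rw [h, zpow_zero, one_smul, h1]
  · by_contra hne
    refine h (he.eq_of_inner_ne_zero 1 i 0 (by simpa using hi) (by simpa using hne) ?_)
    rw [zpow_zero, mul_one, one_smul, h1]
    exact one_ne_zero

variable [SMulCommClass G ℂ E] [IsIsometricSMul G E]

theorem inner_smul_smul_of_isIsometricSMul (g : G) (u v : E) :
    ⟪g • u, g • v⟫_ℂ = ⟪u, v⟫_ℂ :=
  (LinearMap.norm_map_iff_inner_map_map (DistribSMul.toLinearMap ℂ E g)).1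
    (norm_smul_eq_of_isIsometricSMul g) u v

theorem inner_translateSum_smul (a g : G) (e : E) (R : ℕ) (x y : ℤ → ℂ) :
    ⟪translateSum a e R x, g • translateSum a e R y⟫_ℂ =
      ∑ k ∈ Finset.Icc (-R : ℤ) R, ∑ l ∈ Finset.Icc (-R : ℤ) R,
        conj (x k) * y l * ⟪e, (g * a ^ (l - k)) • e⟫_ℂ := by
  simp only [translateSum, Finset.smul_sum, sum_inner, inner_sum, inner_smul_left]
  rw [Finset.sum_comm]
  refine Finset.sum_congr rfl fun k _ => Finset.sum_congr rfl fun l _ => ?_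
  have h : g • a ^ l • e = a ^ k • (g * a ^ (l - k)) • e := by
    rw [smul_smul, smul_smul, mul_left_comm, ← zpow_add, add_sub_cancel]
  rw [smul_comm, inner_smul_right, h, inner_smul_smul_of_isIsometricSMul]
  ring

namespace IsSpreadVector

variable {a : G} {e : E} {n R : ℕ}

theorem inner_translateSum_zpow_smul (he : IsSpreadVector a e n) (hR : 4 * R + 1 < n)
    (x y : ℤ → ℂ) {m : ℤ} (hm : |m| ≤ 2 * R + 1) :
    ⟪translateSum a e R x, a ^ m • translateSum a e R y⟫_ℂ = correlation R x y m := by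
  rw [inner_translateSum_smul]
  refine Finset.sum_congr rfl fun k hk => Finset.sum_congr rfl fun l hl => ?_
  rw [Finset.mem_Icc] at hk hl
  rw [abs_le] at hm
  rw [← zpow_add, he.inner_zpow_smul (abs_lt.2 ⟨by omega, by omega⟩)]
  have : m + (l - k) = 0 ↔ k - l = m := by omega
  simp only [this, mul_ite, mul_one, mul_zero]

theorem norm_translateSum_sq (he : IsSpreadVector a e n) (hR : 4 * R + 1 < n) (x : ℤ → ℂ) :
    ‖translateSum a e R x‖ ^ 2 = (correlation R x x 0).re := by
  rw [← he.inner_translateSum_zpow_smul hR x x (by simp; positivity), zpow_zero, one_smul,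
    ← inner_self_eq_norm_sq (𝕜 := ℂ)]
  rfl

/-- At most one power of `a` contributes to a given matrix coefficient, and it contributes a
multiple of a correlation with factor in `[0, 1]`; if the real part is negative, the vanishing
correlation for `m = 2 * R + 1` is larger. -/
theorem exists_re_inner_translateSum_le (he : IsSpreadVector a e n) (hR : 4 * R + 1 < n)
    (x y : ℤ → ℂ) (g : G) : ∃ m : ℤ, |m| ≤ 2 * R + 1 ∧
      (⟪translateSum a e R x, g • translateSum a e R y⟫_ℂ).re ≤ (correlation R x y m).re := by
  have htop : |(2 * R + 1 : ℤ)| ≤ 2 * R + 1 := (abs_of_nonneg (by positivity)).le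
  by_cases h : ∃ i : ℤ, |i| ≤ 2 * R ∧ ⟪e, (g * a ^ i) • e⟫_ℂ ≠ 0
  · obtain ⟨i, hi, hne⟩ := h
    obtain ⟨r, hr0, hr⟩ := he.inner_nonneg (g * a ^ i)
    have hr1 : r ≤ 1 := by
      have h := norm_inner_le_norm (𝕜 := ℂ) e ((g * a ^ i) • e)
      rwa [hr, norm_smul_eq_of_isIsometricSMul, he.norm_eq_one, one_mul, Complex.norm_real,
        Real.norm_of_nonneg hr0] at h
    have hinner : ⟪translateSum a e R x, g • translateSum a e R y⟫_ℂ
        = r * correlation R x y (-i) := by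
      rw [inner_translateSum_smul, correlation, Finset.mul_sum]
      refine Finset.sum_congr rfl fun k hk => ?_
      rw [Finset.mul_sum]
      refine Finset.sum_congr rfl fun l hl => ?_
      rw [Finset.mem_Icc] at hk hl
      rw [abs_le] at hi
      split_ifs with hkl
      · rw [show l - k = i by omega, hr]
        ring
      · have h0 : ⟪e, (g * a ^ (l - k)) • e⟫_ℂ = 0 := by
          by_contra hne'
          have := he.eq_of_inner_ne_zero g (l - k) i (abs_lt.2 ⟨by omega, by omega⟩) hne' hne
          omega
        rw [h0, mul_zero, mul_zero]
    rw [hinner, Complex.re_ofReal_mul]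
    rcases le_total 0 (correlation R x y (-i)).re with hc | hc
    · exact ⟨-i, by rw [abs_neg]; omega, mul_le_of_le_one_left hc hr1⟩
    · refine ⟨2 * R + 1, htop, ?_⟩
      rw [correlation_two_mul_add_one]
      exact mul_nonpos_of_nonneg_of_nonpos hr0 hc
  · push Not at h
    refine ⟨2 * R + 1, htop, ?_⟩
    rw [correlation_two_mul_add_one, inner_translateSum_smul]
    refine (congrArg Complex.re (Finset.sum_eq_zero fun k hk => Finset.sum_eq_zero
      fun l hl => ?_)).le
    rw [Finset.mem_Icc] at hk hl
    beta_reduce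
    rw [h (l - k) (abs_le.2 ⟨by omega, by omega⟩), mul_zero]

variable {G' E' : Type*} [CommGroup G'] [NormedAddCommGroup E'] [InnerProductSpace ℂ E']
  [DistribMulAction G' E'] [SMulCommClass G' ℂ E'] [IsIsometricSMul G' E'] {a' : G'} {e' : E'}
  {n' : ℕ}

theorem edist_mk_translateSum_le (he : IsSpreadVector a e n) (hR : 4 * R + 1 < n)
    (he' : IsSpreadVector a' e' n') (hR' : 4 * R + 1 < n') (x y : ℤ → ℂ) :
    edist (OrbitSpace.mk G (translateSum a e R x)) (OrbitSpace.mk G (translateSum a e R y)) ≤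
      edist (OrbitSpace.mk G' (translateSum a' e' R x))
        (OrbitSpace.mk G' (translateSum a' e' R y)) := by
  rw [OrbitSpace.edist_mk_mk, OrbitSpace.edist_mk_mk]
  refine le_iInf fun g => ?_
  obtain ⟨m, hm, hle⟩ := he'.exists_re_inner_translateSum_le hR' x y g
  refine iInf_le_of_le (a ^ m) ?_
  rw [edist_dist, edist_dist, dist_eq_norm, dist_eq_norm]
  refine ENNReal.ofReal_le_ofReal ((sq_le_sq₀ (norm_nonneg _) (norm_nonneg _)).1 ?_)
  rw [@norm_sub_sq ℂ, @norm_sub_sq ℂ, norm_smul_eq_of_isIsometricSMul,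
    norm_smul_eq_of_isIsometricSMul, he.norm_translateSum_sq hR, he.norm_translateSum_sq hR,
    he'.norm_translateSum_sq hR', he'.norm_translateSum_sq hR',
    he.inner_translateSum_zpow_smul hR x y hm]
  simp only [RCLike.re_to_complex]
  linarith

/-- The distance of the orbits of two finite combinations of translates of a spread vector depends
on the coefficients only. -/
theorem edist_mk_translateSum_eq (he : IsSpreadVector a e n) (hR : 4 * R + 1 < n)
    (he' : IsSpreadVector a' e' n') (hR' : 4 * R + 1 < n') (x y : ℤ → ℂ) :
    edist (OrbitSpace.mk G (translateSum a e R x)) (OrbitSpace.mk G (translateSum a e R y)) =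
      edist (OrbitSpace.mk G' (translateSum a' e' R x))
        (OrbitSpace.mk G' (translateSum a' e' R y)) :=
  (he.edist_mk_translateSum_le hR he' hR' x y).antisymm
    (he'.edist_mk_translateSum_le hR' he hR x y)

end IsSpreadVector

end TranslateSum

/-! ### Translates of the delta sequence in `ℓ²(ℤ)` -/

namespace EllTwoInt

theorem smul_apply (k : Multiplicative ℤ) (a : EllTwoInt) (i : ℤ) :
    (k • a) i = a (i - k.toAdd) := rfl

noncomputable instance : DistribMulAction (Multiplicative ℤ) EllTwoInt where
  smul_zero _ := rfl
  smul_add _ _ _ := rfl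

instance : SMulCommClass (Multiplicative ℤ) ℂ EllTwoInt where
  smul_comm _ _ _ := rfl

/-- The generator of `ℤ`, which shifts a sequence one step to the right. -/
def shift : Multiplicative ℤ := Multiplicative.ofAdd 1

/-- The delta sequence at `0`. -/
noncomputable def delta : EllTwoInt := lp.single 2 0 1

theorem toAdd_shift_zpow (k : ℤ) : (shift ^ k).toAdd = k := by
  simp [shift]

theorem smul_delta_apply (k : Multiplicative ℤ) (i : ℤ) :
    (k • delta) i = if i = k.toAdd then 1 else 0 := by
  rw [smul_apply, delta, lp.single_apply, Pi.single_apply]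
  simp only [sub_eq_zero]

theorem shift_zpow_smul_delta (k : ℤ) (z : ℂ) :
    z • shift ^ k • delta = (lp.single 2 k z : EllTwoInt) := by
  apply lp.ext
  funext i
  rw [lp.coeFn_smul, Pi.smul_apply, smul_delta_apply, toAdd_shift_zpow, lp.single_apply,
    Pi.single_apply]
  simp

theorem inner_delta_smul (k : Multiplicative ℤ) :
    ⟪delta, k • delta⟫_ℂ = if k.toAdd = 0 then 1 else 0 := by
  conv_lhs => rw [delta, lp.inner_single_left, ← delta, smul_delta_apply]
  simp [eq_comm]

theorem isSpreadVector_delta (n : ℕ) : IsSpreadVector shift delta n where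
  norm_eq_one := by simp [delta, lp.norm_single]
  inner_nonneg k := by
    rw [inner_delta_smul]
    split_ifs
    · exact ⟨1, zero_le_one, by simp⟩
    · exact ⟨0, le_rfl, by simp⟩
  eq_of_inner_ne_zero k i j _ hi hj := by
    simp only [inner_delta_smul, toAdd_mul, toAdd_shift_zpow, ne_eq, ite_eq_right_iff, one_ne_zero,
      imp_false, not_not] at hi hj
    omega

theorem tendsto_translateSum (x : EllTwoInt) :
    Tendsto (fun R : ℕ => translateSum shift delta R x) atTop (𝓝 x) := by
  have h := (lp.hasSum_single ENNReal.ofNat_ne_top x).comp (Finset.tendsto_Icc_neg (R := ℤ))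
  refine h.congr fun R => ?_
  simp only [translateSum, shift_zpow_smul_delta]
  rfl

end EllTwoInt

/-! ### Spread vectors in `L²` -/

/-- A generator `a` of a discrete cyclic subgroup of order at least `n`: the powers of `a` with
exponents between `-n` and `n` other than `a ^ 0` stay away from `1`. -/
theorem exists_nhds_one_zpow_mem {G : Type*} [Group G] [TopologicalSpace G] {n : ℕ}
    (h : ∃ H : Subgroup G, IsCyclic H ∧ DiscreteTopology H ∧ (n : ℕ∞) ≤ ENat.card H) :
    ∃ a : G, ∃ V ∈ 𝓝 (1 : G), ∀ i : ℤ, |i| < n → a ^ i ∈ V → i = 0 := by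
  obtain ⟨H, hcyc, hdisc, hcard⟩ := h
  obtain ⟨b, hb⟩ := hcyc.exists_generator
  obtain ⟨V, hV, hVH⟩ := mem_nhds_subtype (H : Set G) 1 {1} |>.1
    ((isOpen_discrete ({1} : Set H)).mem_nhds rfl)
  refine ⟨b, V, by simpa using hV, fun i hi hiV => ?_⟩
  have hbi : b ^ i = 1 := hVH (show ((b ^ i : H) : G) ∈ V by simpa using hiV)
  have hdvd : (orderOf b : ℤ) ∣ i := orderOf_dvd_iff_zpow_eq_one.2 hbi
  by_cases h0 : orderOf b = 0
  · rw [h0] at hdvd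
    simpa using hdvd
  · have hord : orderOf b = Nat.card H := orderOf_eq_card_of_forall_mem_zpowers hb
    have : Finite H := Nat.finite_of_card_ne_zero (hord ▸ h0)
    have hn : n ≤ orderOf b := by
      rw [ENat.card_eq_coe_natCard, ← hord] at hcard
      exact_mod_cast hcard
    exact Int.eq_zero_of_abs_lt_dvd hdvd (hi.trans_le (by exact_mod_cast hn))

/-- Suppose that the neighborhood `V` of `1` contains no `a ^ i` with `0 < |i| < n`. If `U` is an
open neighborhood of `1` such that the quotients of quotients of elements of `U` lie in `V`, then
the normalized indicator function of the product of `U` with a subset of `Ω` is a spread vector. -/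
theorem exists_isSpreadVector_Lp {G X : Type*} [CommGroup G] [TopologicalSpace G]
    [IsTopologicalGroup G] [LocallyCompactSpace G] [MeasurableSpace G] [BorelSpace G]
    (haar : Measure G) [haar.IsHaarMeasure] [MeasurableSpace X] (μ : Measure X) [MulAction G X]
    [MeasurableConstSMul G X] [SMulInvariantMeasure G X μ] {Ω : Set X} (ν : Measure Ω)
    [SigmaFinite ν] (hν : ν ≠ 0)
    (hiso : IsMeasureSpaceIso (fun p : G × Ω => p.1 • (p.2 : X)) (haar.prod ν) μ)
    {n : ℕ} {a : G} {V : Set G} (hV : V ∈ 𝓝 1) (hVa : ∀ i : ℤ, |i| < n → a ^ i ∈ V → i = 0) :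
    ∃ e : Lp ℂ 2 μ, IsSpreadVector (DomMulAct.mk a) e n := by
  obtain ⟨W, hW, hWV⟩ := exists_nhds_split_inv hV
  obtain ⟨U₀, hU₀, hU₀W⟩ := exists_nhds_split_inv hW
  obtain ⟨K, hK, hK1⟩ := exists_compact_mem_nhds (1 : G)
  obtain ⟨U, hUsub, hUo, hU1⟩ := mem_nhds_iff.1 (inter_mem hU₀ hK1)
  have hUpos : haar U ≠ 0 := (hUo.measure_pos haar ⟨1, hU1⟩).ne'
  have hUfin : haar U ≠ ∞ :=
    ((measure_mono (hUsub.trans Set.inter_subset_right)).trans_lt hK.measure_lt_top).ne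
  obtain ⟨A, hA, -, hApos, hAfin⟩ := Measure.exists_subset_measure_lt_top (μ := ν) (r := 0)
    MeasurableSet.univ (pos_iff_ne_zero.2 (Measure.measure_univ_ne_zero.2 hν))
  obtain ⟨ε, hε, hmp⟩ := hiso
  have hεapp : ∀ p : G × Ω, ε p = p.1 • (p.2 : X) := fun p => congrFun hε p
  set S : Set X := ε.symm ⁻¹' (U ×ˢ A)
  have hS : MeasurableSet S := ε.symm.measurable (hUo.measurableSet.prod hA)
  have hμS : μ S = haar U * ν A := by
    rw [← hmp.measure_preimage hS.nullMeasurableSet, ← hε, ← Measure.prod_prod]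
    congr 1
    ext p
    simp [S]
  have hμS0 : μ S ≠ 0 := by rw [hμS]; exact mul_ne_zero hUpos hApos.ne'
  have hμSt : μ S ≠ ∞ := by rw [hμS]; exact ENNReal.mul_ne_top hUfin hAfin.ne
  have hreal : 0 < μ.real S := ENNReal.toReal_pos hμS0 hμSt
  set c : ℝ := (μ.real S ^ (1 / (2 : ℝ≥0∞).toReal))⁻¹
  have hc : 0 < c := inv_pos.2 (Real.rpow_pos_of_pos hreal _)
  have hinner : ∀ g : Gᵈᵐᵃ, ⟪indicatorConstLp 2 hS hμSt (c : ℂ),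
      g • indicatorConstLp 2 hS hμSt (c : ℂ)⟫_ℂ =
        ((μ.real (S ∩ (DomMulAct.mk.symm g • ·) ⁻¹' S) * (c * c) : ℝ) : ℂ) := fun g => by
    rw [← DomMulAct.mk.apply_symm_apply g, DomMulAct.mk_smul_indicatorConstLp,
      L2.inner_indicatorConstLp_indicatorConstLp hS _ hμSt
        (by rwa [measure_preimage_smul_of_nullMeasurableSet hS.nullMeasurableSet])]
    simp [sq, abs_of_pos hc]
  -- A point of `S` that `h` maps into `S` has the form `u • ω` and is mapped to some `u' • ω'`;
  -- by uniqueness `h` is a quotient of elements of `U`.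
  have hmem : ∀ h : G, (S ∩ (h • ·) ⁻¹' S).Nonempty → h ∈ W := by
    rintro h ⟨x, hx, hhx⟩
    have hmul : ε (h * (ε.symm x).1, (ε.symm x).2) = h • x := by
      rw [hεapp, mul_smul, ← hεapp (ε.symm x), ε.apply_symm_apply]
    have hsymm : ε.symm (h • x) = (h * (ε.symm x).1, (ε.symm x).2) := by
      rw [← hmul, ε.symm_apply_apply]
    have h1 : (ε.symm x).1 ∈ U := hx.1
    have h2 : h * (ε.symm x).1 ∈ U := by
      have : (ε.symm (h • x)).1 ∈ U := hhx.1
      rwa [hsymm] at this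
    have := hU₀W _ (hUsub h2).1 _ (hUsub h1).1
    rwa [mul_div_cancel_right] at this
  have hne : ∀ g : Gᵈᵐᵃ, ⟪indicatorConstLp 2 hS hμSt (c : ℂ),
      g • indicatorConstLp 2 hS hμSt (c : ℂ)⟫_ℂ ≠ 0 → DomMulAct.mk.symm g ∈ W := fun g hg => by
    refine hmem _ (Set.nonempty_iff_ne_empty.2 fun hempty => hg ?_)
    rw [hinner, hempty]
    simp
  refine ⟨indicatorConstLp 2 hS hμSt (c : ℂ), ?_, fun g => ?_, fun g i j hij hi hj => ?_⟩
  · rw [norm_indicatorConstLp two_ne_zero ENNReal.ofNat_ne_top, Complex.norm_real,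
      Real.norm_of_nonneg hc.le]
    exact inv_mul_cancel₀ (Real.rpow_pos_of_pos hreal _).ne'
  · exact ⟨_, by positivity, hinner g⟩
  · have hdiv := hWV _ (hne _ hi) _ (hne _ hj)
    rw [DomMulAct.symm_mk_mul, DomMulAct.symm_mk_mul, DomMulAct.symm_mk_zpow,
      DomMulAct.symm_mk_zpow, Equiv.symm_apply_apply, mul_div_mul_right_eq_div,
      div_eq_mul_inv,
      ← zpow_sub] at hdiv
    exact sub_eq_zero.1 (hVa _ hij hdiv)

/-! ### The Euclidean distortion of `ℓ²(ℤ) / ℤ` -/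

theorem mainTheorem11 {G X : ℕ → Type*}
    [∀ n, CommGroup (G n)] [∀ n, TopologicalSpace (G n)] [∀ n, IsTopologicalGroup (G n)]
    [∀ n, LocallyCompactSpace (G n)] [∀ n, SecondCountableTopology (G n)]
    [∀ n, MeasurableSpace (G n)] [∀ n, BorelSpace (G n)]
    (haar : ∀ n, Measure (G n)) [∀ n, (haar n).IsHaarMeasure]
    [∀ n, MeasurableSpace (X n)] (μ : ∀ n, Measure (X n))
    [∀ n, MulAction (G n) (X n)] [∀ n, MeasurableConstSMul (G n) (X n)]
    [∀ n, SMulInvariantMeasure (G n) (X n) (μ n)]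
    (hfree : ∀ n (g : G n) (x : X n), g • x = x → g = 1)
    (hcyclic : ∀ n, ∃ H : Subgroup (G n),
      IsCyclic H ∧ DiscreteTopology H ∧ (n : ℕ∞) ≤ ENat.card H)
    (Ω : ∀ n, Set (X n)) (hΩ : ∀ n, IsMeasurableFundamentalDomain (G n) (Ω n))
    (ν : ∀ n, Measure (Ω n)) [∀ n, SigmaFinite (ν n)] (hν : ∀ n, ν n ≠ 0)
    (hsep : ∀ n, TopologicalSpace.SeparableSpace (Lp ℂ 2 (ν n)))
    (hiso : ∀ n, IsMeasureSpaceIso (fun p : G n × Ω n => p.1 • (p.2 : X n))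
      ((haar n).prod (ν n)) (μ n)) :
    euclideanDistortion (OrbitSpace (Multiplicative ℤ) EllTwoInt) ≤
      liminf (fun n => euclideanDistortion (LTwoQuotient (G n) (X n) (μ n))) atTop := by
  have hspread : ∀ n, ∃ (a : (G n)ᵈᵐᵃ) (e : Lp ℂ 2 (μ n)), IsSpreadVector a e n := fun n => by
    obtain ⟨a, V, hV, hVa⟩ := exists_nhds_one_zpow_mem (hcyclic n)
    exact ⟨_, exists_isSpreadVector_Lp (haar n) (μ n) (ν n) (hν n) (hiso n) hV hVa⟩
  choose a e he using hspread
  have hrep : ∀ A : OrbitSpace (Multiplicative ℤ) EllTwoInt, ∃ x, OrbitSpace.mk _ x = A :=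
    OrbitSpace.mk_surjective
  choose rep hrep using hrep
  -- The half-width `R` of the window satisfies `4 * R + 1 < n` as soon as `2 ≤ n`.
  let R : ℕ → ℕ := fun n => (n - 2) / 4
  have hR : Tendsto R atTop atTop :=
    (Nat.tendsto_div_const_atTop four_ne_zero).comp (tendsto_sub_atTop_nat 2)
  have : Nonempty (OrbitSpace (Multiplicative ℤ) EllTwoInt) := ⟨OrbitSpace.mk _ 0⟩
  refine euclideanDistortion_le_liminf (OrbitSpace.edist_ne_top_of_forall edist_ne_top)
    (fun n => OrbitSpace.edist_ne_top_of_forall edist_ne_top)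
    (fun n A => OrbitSpace.mk _ (translateSum (a n) (e n) (R n) (rep A))) fun A B => ?_
  have hmk : ∀ A : OrbitSpace (Multiplicative ℤ) EllTwoInt, Tendsto (fun n =>
      OrbitSpace.mk (Multiplicative ℤ)
        (translateSum EllTwoInt.shift EllTwoInt.delta (R n) (rep A))) atTop (𝓝 A) := fun A => by
    conv => enter [3]; rw [← hrep A]
    have hlip : LipschitzWith 1 (OrbitSpace.mk (Multiplicative ℤ) (X := EllTwoInt)) :=
      LipschitzWith.of_edist_le OrbitSpace.edist_mk_mk_le
    exact (hlip.continuous.tendsto _).comp ((EllTwoInt.tendsto_translateSum _).comp hR)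
  refine ((hmk A).edist (hmk B)).congr' ?_
  filter_upwards [eventually_ge_atTop 2] with n hn
  have hRn : 4 * R n + 1 < n := by
    simp only [R]
    omega
  exact (EllTwoInt.isSpreadVector_delta n).edist_mk_translateSum_eq hRn (he n) hRn _ _
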